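/- All graphs are finite and simple. A path decomposition of a graph $G=(V,E)$ is a finite sequence of bags $B_1,\dots,B_n\subseteq V$ such that every vertex lies in some bag; $v\in B_i\cap B_j$ and $i\le m\le j$ imply $v\in B_m$; and both ends of every edge lie in a common bag. Its width is $\max_i|B_i|-1$, and the pathwidth $\operatorname{pw}(G)$ is the minimum width of a path decomposition of $G$. In the zero-visibility cops and robber game, $k$ cops start on arbitrary vertices of $G$ (several cops may share a vertex), and in each later turn every cop stays where it is or moves to an adjacent vertex. Let $P_t$ be the set of vertices occupied by cops at the end of turn $t\ge 0$, and let $R_t$ and $S_t$ be the sets of dirty vertices immediately before and after the cops' turn $t$: $R_0=V$, $S_t=R_t\setminus P_t$ and $R_{t+1}=(N(S_t)\cup S_t)\setminus P_t$, where $N(S)$ is the set of vertices outside $S$ that are adjacent to a vertex of $S$. The cops clear $G$ if $S_t=\emptyset$ for some $t$. The zero-visibility cop number $c_0(G)$ is the minimum number of cops that can clear $G$. Corollary. For every (finite) tree $T$ with at least two vertices, $$\left\lceil \frac{\operatorname{pw}(T)}{2}\right\rceil \le c_0(T)\le \operatorname{pw}(T).$$ -/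

import Mathlib

namespace ZeroVisibility

variable {V : Type*}

/-- A path decomposition of `G`: a finite sequence of bags that covers the vertices, in which every
vertex occupies an interval of bags, and in which the ends of every edge share a bag. -/
structure PathDecomposition (G : SimpleGraph V) where
  numBags : ℕ
  bag : Fin numBags → Finset V
  cover : ∀ v, ∃ i, v ∈ bag i
  interval : ∀ i m j, i ≤ m → m ≤ j → ∀ v, v ∈ bag i → v ∈ bag j → v ∈ bag m
  edge : ∀ u v, G.Adj u v → ∃ i, u ∈ bag i ∧ v ∈ bag i

/-- The largest size of a bag, minus one. On a nonempty vertex set some bag is nonempty, so the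
subtraction does not truncate. -/
def PathDecomposition.width {G : SimpleGraph V} (B : PathDecomposition G) : ℕ :=
  (Finset.univ.sup fun i => (B.bag i).card) - 1

/-- The pathwidth: the minimum width of a path decomposition. -/
noncomputable def pathwidth (G : SimpleGraph V) : ℕ :=
  sInf {w | ∃ B : PathDecomposition G, B.width = w}

/-- The open neighborhood of a set of vertices. -/
def openNbhd (G : SimpleGraph V) (S : Set V) : Set V :=
  {w | w ∉ S ∧ ∃ v ∈ S, G.Adj w v}

/-- A schedule of `k` cops: `pos t c` is the vertex of cop `c` at the end of turn `t`. Initial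
vertices are arbitrary (several cops may share a vertex); after that, in each turn every cop stays
or moves to an adjacent vertex. -/
structure CopSchedule (G : SimpleGraph V) (k : ℕ) where
  pos : ℕ → Fin k → V
  move : ∀ t c, pos (t + 1) c = pos t c ∨ G.Adj (pos t c) (pos (t + 1) c)

namespace CopSchedule

variable {G : SimpleGraph V} {k : ℕ}

/-- The vertices occupied by cops at the end of turn `t`. -/
def occupied (π : CopSchedule G k) (t : ℕ) : Set V := Set.range (π.pos t)

/-- The dirty vertices immediately before the cops' turn `t`. Dirt stays where it is and spreads to
all neighbors, except onto vertices that a cop occupies. -/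
def dirtyBefore (π : CopSchedule G k) : ℕ → Set V
  | 0 => Set.univ
  | t + 1 =>
    (openNbhd G (π.dirtyBefore t \ π.occupied t) ∪ (π.dirtyBefore t \ π.occupied t)) \ π.occupied t

/-- The dirty vertices immediately after the cops' turn `t`. -/
def dirtyAfter (π : CopSchedule G k) (t : ℕ) : Set V := π.dirtyBefore t \ π.occupied t

/-- The schedule clears the graph if after some turn no vertex is dirty. -/
def Clears (π : CopSchedule G k) : Prop := ∃ t, π.dirtyAfter t = ∅

end CopSchedule

/-- The zero-visibility cop number: the minimum number of cops that can clear `G`. -/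
noncomputable def copNumber (G : SimpleGraph V) : ℕ :=
  sInf {k | ∃ π : CopSchedule G k, π.Clears}

/-- On a finite graph the minimum in the definition of `pathwidth` is over a nonempty set. -/
theorem pathwidth_set_nonempty [Fintype V] (G : SimpleGraph V) :
    {w | ∃ B : PathDecomposition G, B.width = w}.Nonempty :=
  ⟨_, ⟨1, fun _ => Finset.univ, fun _ => ⟨0, Finset.mem_univ _⟩,
    fun _ _ _ _ _ _ _ _ => Finset.mem_univ _,
    fun _ _ _ => ⟨0, Finset.mem_univ _, Finset.mem_univ _⟩⟩, rfl⟩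

/-- On a finite graph the minimum in the definition of `copNumber` is over a nonempty set. -/
theorem copNumber_set_nonempty [Fintype V] (G : SimpleGraph V) :
    {k | ∃ π : CopSchedule G k, π.Clears}.Nonempty := by
  refine ⟨Fintype.card V, ⟨fun _ => (Fintype.equivFin V).symm, fun _ _ => Or.inl rfl⟩, 0, ?_⟩
  simp [CopSchedule.dirtyAfter, CopSchedule.dirtyBefore, CopSchedule.occupied]

end ZeroVisibility

/-! Both bounds pass through `Sweep`, the vertex-separation form of pathwidth: vertices are added
one at a time, and the bag is the new vertex together with the outer boundary of the enlarged set.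

The lower bound, in the form `pathwidth T ≤ 2 * copNumber T`, is an induction on the number of cops
(`sweep_of_clears`). If a tree has no sweep of width 2m+2, some vertex v has three branches without
a sweep of width 2m+1 (`exists_three_not_light`), and each of these contains, one edge further out,
an inner branch without a sweep of width 2m (`light_succ`). By induction m cops clear none of the
inner branches, so dirt can survive in an inner branch as long as one of m+1 cops is outside it.
Call it an event when all m+1 cops are in one inner branch. Inner branches are two edges away from
v, so at an event surviving dirt has followed the cops to v, and afterwards it spreads from v ahead
of them. Between consecutive events some inner branch is never full and keeps its dirt. Hence v is
dirty at every event, and the tree is never clean (`not_clears_of_spider`).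

For the upper bound, a decomposition of width k gives a sweep of width k
(`PathDecomposition.sweep`). Then k cops guard the boundary of the swept set. A bag may have k+1
vertices, but the new vertex needs no cop of its own: its cop slides on to a new boundary vertex, or
a cop on a neighbor steps onto it and back (`Guards.insert_vertex`). -/

namespace ZeroVisibility

open SimpleGraph

/-! ### Branches of a forest at an edge. -/

section Branch

variable {V : Type*} {G : SimpleGraph V}

/-- The vertices on the side of `x` when the edge `ux` is deleted. -/
def branch (G : SimpleGraph V) (u x : V) : Set V :=
  {y | (G.deleteEdges {s(u, x)}).Reachable x y}

theorem self_mem_branch (u x : V) : x ∈ branch G u x := Reachable.refl _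

theorem notMem_branch (hG : G.IsAcyclic) {u x : V} (h : G.Adj u x) : u ∉ branch G u x := by
  have := isAcyclic_iff_forall_adj_isBridge.1 hG h
  rw [isBridge_iff] at this
  exact fun h' => this (Reachable.symm h')

theorem branch_boundary (hG : G.IsAcyclic) {u x y z : V} (h : G.Adj u x)
    (hy : y ∈ branch G u x) (hz : z ∉ branch G u x) (hyz : G.Adj y z) : y = x ∧ z = u := by
  by_contra hne
  by_cases he : s(y, z) = s(u, x)
  · rcases Sym2.eq_iff.1 he with ⟨rfl, rfl⟩ | ⟨rfl, rfl⟩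
    · exact notMem_branch hG h hy
    · exact hne ⟨rfl, rfl⟩
  · exact hz (Reachable.trans hy (Adj.reachable ((deleteEdges_adj).2 ⟨hyz, he⟩)))

/-- The induction principle for branches: follow a walk from the root. -/
theorem branch_subset {u x : V} {A : Set V} (hx : x ∈ A)
    (h : ∀ y z, y ∈ branch G u x → z ∈ branch G u x → y ∈ A → G.Adj y z → z ∈ A) :
    branch G u x ⊆ A := by
  have key : ∀ a b, (G.deleteEdges {s(u, x)}).Walk a b → a ∈ branch G u x → a ∈ A → b ∈ A := by
    intro a b p
    induction p with
    | nil => exact fun _ h => h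
    | cons hab p ih =>
      intro ha haA
      have hb := Reachable.trans ha hab.reachable
      exact ih hb (h _ _ ha hb haA ((deleteEdges_le _) hab))
  rintro y ⟨p⟩
  exact key _ _ p (self_mem_branch u x) hx

theorem eq_of_mem_branch (hG : G.IsAcyclic) {u x y : V} (hx : G.Adj u x) (hy : G.Adj u y)
    (h : y ∈ branch G u x) : y = x :=
  (branch_boundary hG hx h (notMem_branch hG hx) hy.symm).1

theorem branch_subset_branch (hG : G.IsAcyclic) {v u x : V} (hu : G.Adj v u) (hx : G.Adj u x)
    (hne : x ≠ v) : branch G u x ⊆ branch G v u := by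
  refine branch_subset ?_ fun y z hy _ hyA hyz => ?_
  · by_contra hxn
    exact hne (branch_boundary hG hu (self_mem_branch v u) hxn hx).2
  · by_contra hzn
    obtain ⟨rfl, -⟩ := branch_boundary hG hu hyA hzn hyz
    exact notMem_branch hG hx hy

theorem branch_disjoint (hG : G.IsAcyclic) {u x y : V} (hx : G.Adj u x) (hy : G.Adj u y)
    (hne : x ≠ y) : Disjoint (branch G u x) (branch G u y) := by
  rw [← Set.subset_compl_iff_disjoint_right]
  refine branch_subset (fun h => hne (eq_of_mem_branch hG hy hx h)) fun p z hp _ hpA hpz hz => ?_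
  obtain ⟨-, rfl⟩ := branch_boundary hG hy hz hpA hpz.symm
  exact notMem_branch hG hx hp

theorem isTree_induce_branch (hG : G.IsAcyclic) (u x : V) : (G.induce (branch G u x)).IsTree := by
  have key : branch G u x ⊆ {y | ∃ h : y ∈ branch G u x,
      (G.induce (branch G u x)).Reachable ⟨x, self_mem_branch u x⟩ ⟨y, h⟩} := by
    refine branch_subset ⟨self_mem_branch u x, Reachable.refl _⟩ ?_
    rintro y z hy hz ⟨_, hr⟩ hyz
    refine ⟨hz, hr.trans (Adj.reachable ?_)⟩
    exact hyz
  refine ⟨?_, hG.induce _⟩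
  rw [connected_iff_exists_forall_reachable]
  refine ⟨⟨x, self_mem_branch u x⟩, fun y => ?_⟩
  obtain ⟨_, h⟩ := key y.2
  exact h

theorem eq_univ_of_no_boundary (hG : G.Connected) {C : Set V} {u : V} (hu : u ∈ C)
    (h : ∀ y ∈ C, ∀ z, G.Adj y z → z ∈ C) : C = Set.univ := by
  have key : ∀ a b, G.Walk a b → a ∈ C → b ∈ C := by
    intro a b p
    induction p with
    | nil => exact id
    | cons hab p ih => exact fun ha => ih (h _ ha _ hab)
  refine Set.eq_univ_of_forall fun y => ?_
  obtain ⟨p⟩ := hG u y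
  exact key _ _ p hu

end Branch

/-! ### Sweeps, and a vertex with three heavy branches in trees without a narrow sweep. -/

section Sweep

variable {V : Type*} {G : SimpleGraph V}

/-- The vertices of `B` outside `D` that have a neighbor in `D`. -/
def outerBoundary (G : SimpleGraph V) (B D : Set V) : Set V :=
  {z | z ∈ B ∧ z ∉ D ∧ ∃ y ∈ D, G.Adj y z}

/-- `Sweep G B w D E`: the set `D` can be enlarged to `E` one vertex at a time so that each added
vertex, together with the outer boundary in `B` of the set that results, has at most `w + 1`
elements. -/
inductive Sweep (G : SimpleGraph V) (B : Set V) (w : ℕ) (D : Set V) : Set V → Prop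
  | refl : Sweep G B w D D
  | step {E : Set V} (v : V) : Sweep G B w D E →
      (insert v (outerBoundary G B (insert v E))).ncard ≤ w + 1 → Sweep G B w D (insert v E)

/-- The branch has a sweep of width `w` of its own. -/
def Light (G : SimpleGraph V) (w : ℕ) (u x : V) : Prop :=
  Sweep G (branch G u x) w ∅ (branch G u x)

theorem Sweep.trans {B : Set V} {w : ℕ} {D E F : Set V} (h : Sweep G B w D E)
    (h' : Sweep G B w E F) : Sweep G B w D F := by
  induction h' with
  | refl => exact h
  | step v _ hv ih => exact ih.step v hv

variable [Finite V]

theorem Sweep.restrict {A B : Set V} {w : ℕ} {D E : Set V} (hAB : A ⊆ B) (h : Sweep G B w D E) :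
    Sweep G A w (D ∩ A) (E ∩ A) := by
  induction h with
  | refl => exact .refl
  | @step E v _ hv ih =>
    by_cases hvA : v ∈ A
    · rw [Set.insert_inter_of_mem hvA]
      refine ih.step v (le_trans (Set.ncard_le_ncard ?_ (Set.toFinite _)) hv)
      refine Set.insert_subset_insert ?_
      rintro z ⟨hzA, hzn, y, hy, hyz⟩
      refine ⟨hAB hzA, fun hz => hzn ?_, y, ?_, hyz⟩
      · rcases hz with rfl | hz
        · exact Or.inl rfl
        · exact Or.inr ⟨hz, hzA⟩
      · rcases hy with rfl | hy
        · exact Or.inl rfl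
        · exact Or.inr hy.1
    · rw [Set.insert_inter_of_notMem hvA]
      exact ih

/-- Transfers a sweep of a part to the whole when the rest contributes at most one boundary vertex
`u`; that vertex costs one unit of width. -/
theorem Sweep.extend {B B' C : Set V} {w : ℕ} {D E : Set V} {u : V} (h : Sweep G B w D E)
    (hu : ∀ F, F ⊆ E → outerBoundary G B' (C ∪ F) ⊆ insert u (outerBoundary G B F)) :
    Sweep G B' (w + 1) (C ∪ D) (C ∪ E) := by
  induction h with
  | refl => exact .refl
  | @step E v _ hv ih =>
    rw [Set.union_insert]
    refine (ih fun F hF => hu F (hF.trans (Set.subset_insert _ _))).step v ?_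
    have h1 := hu _ subset_rfl
    rw [Set.union_insert] at h1
    calc _ ≤ (insert u (insert v (outerBoundary G B (insert v E)))).ncard := by
          refine Set.ncard_le_ncard ?_ (Set.toFinite _)
          rw [Set.insert_comm]
          exact Set.insert_subset_insert h1
      _ ≤ _ := (Set.ncard_insert_le _ _).trans (by omega)

theorem Light.mono {w : ℕ} {u x u' x' : V} (hs : branch G u x ⊆ branch G u' x')
    (h : Light G w u' x') : Light G w u x := by
  have := Sweep.restrict hs h
  rwa [Set.empty_inter, Set.inter_eq_right.2 hs] at this

theorem sweep_branches (hG : G.IsAcyclic) {w : ℕ} (B' : Set V) {C : Set V} {u : V}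
    (hC : ∀ y ∈ C, ∀ z, z ∉ C → G.Adj y z → z = u) (X : Finset V)
    (hX : ∀ x ∈ X, G.Adj u x ∧ Light G w u x) :
    Sweep G B' (w + 1) C (C ∪ ⋃ x ∈ X, branch G u x) := by
  classical
  induction X using Finset.induction_on with
  | empty => simpa using Sweep.refl
  | @insert a X ha ih =>
    have ih' := ih fun x hx => hX x (Finset.mem_insert_of_mem hx)
    obtain ⟨hua, hl⟩ := hX a (Finset.mem_insert_self _ _)
    have h2 : Sweep G B' (w + 1) ((C ∪ ⋃ x ∈ X, branch G u x) ∪ ∅)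
        ((C ∪ ⋃ x ∈ X, branch G u x) ∪ branch G u a) := by
      refine Sweep.extend (u := u) hl fun F hF => ?_
      rintro z ⟨-, hzn, y, hy, hyz⟩
      rcases hy with (hy | hy) | hy
      · exact Or.inl (hC y hy z (fun h => hzn (Or.inl (Or.inl h))) hyz)
      · simp only [Set.mem_iUnion] at hy
        obtain ⟨x, hx, hy⟩ := hy
        refine Or.inl (branch_boundary hG (hX x (Finset.mem_insert_of_mem hx)).1 hy ?_ hyz).2
        exact fun h => hzn (Or.inl (Or.inr (Set.mem_biUnion hx h)))
      · by_cases hz : z ∈ branch G u a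
        · exact Or.inr ⟨hz, fun h => hzn (Or.inr h), y, hy, hyz⟩
        · exact Or.inl (branch_boundary hG hua (hF hy) hz hyz).2
    rw [Set.union_empty] at h2
    have h3 := ih'.trans h2
    rwa [Set.union_assoc, Set.union_comm _ (branch G u a), ← Finset.set_biUnion_insert] at h3

/-- A branch that is light after the removal of its root is light one level up. -/
theorem light_succ (hG : G.IsAcyclic) {w : ℕ} {v u : V} (hu : G.Adj v u)
    (h : ∀ x, G.Adj u x → x ≠ v → Light G w u x) : Light G (w + 1) v u := by
  classical
  have := Fintype.ofFinite V
  let X : Finset V := Finset.univ.filter fun x => G.Adj u x ∧ x ≠ v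
  have h1 : Sweep G (branch G v u) (w + 1) ∅ (∅ ∪ ⋃ x ∈ X, branch G u x) :=
    sweep_branches hG _ (u := u) (by simp) X fun x hx => by
      simp only [X, Finset.mem_filter] at hx
      exact ⟨hx.2.1, h x hx.2.1 hx.2.2⟩
  rw [Set.empty_union] at h1
  have hE : insert u (⋃ x ∈ X, branch G u x) = branch G v u := by
    refine Set.Subset.antisymm ?_ ?_
    · refine Set.insert_subset (self_mem_branch v u) (Set.iUnion₂_subset fun x hx => ?_)
      simp only [X, Finset.mem_filter] at hx
      exact branch_subset_branch hG hu hx.2.1 hx.2.2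
    · refine branch_subset (Set.mem_insert _ _) fun y z hy hz hyA hyz => ?_
      rcases hyA with rfl | hyA
      · refine Or.inr (Set.mem_biUnion (x := z) ?_ (self_mem_branch y z))
        simp only [X, Finset.mem_coe, Finset.mem_filter, Finset.mem_univ, true_and]
        exact ⟨hyz, fun h => notMem_branch hG hu (h ▸ hz)⟩
      · simp only [Set.mem_iUnion] at hyA
        obtain ⟨x, hx, hy⟩ := hyA
        by_cases hzx : z ∈ branch G u x
        · exact Or.inr (Set.mem_biUnion hx hzx)
        · simp only [X, Finset.mem_filter] at hx
          exact Or.inl (branch_boundary hG hx.2.1 hy hzx hyz).2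
  have h2 := h1.step u (by
    rw [hE]
    have : outerBoundary G (branch G v u) (branch G v u) = ∅ :=
      Set.eq_empty_of_forall_notMem fun z hz => hz.2.1 hz.1
    rw [this]
    simp)
  rwa [hE] at h2

/-- The sweep follows a path of heavy branches. At `u` all light branches are swept, then `u`, and
at most one heavy direction `z` is left. The last hypothesis keeps this true at `z`: either the
branch back to `u` is heavy, so `h3` allows only one other heavy branch at `z`, or no vertex has two
heavy branches at all. -/
theorem sweep_univ_of_boundary (hG : G.IsTree) {w : ℕ}
    (h3 : ∀ y z₁ z₂ z₃, G.Adj y z₁ → G.Adj y z₂ → G.Adj y z₃ → z₁ ≠ z₂ → z₁ ≠ z₃ → z₂ ≠ z₃ →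
      Light G w y z₁ ∨ Light G w y z₂ ∨ Light G w y z₃) (n : ℕ) : ∀ (C : Set V) (u : V),
    Cᶜ.ncard ≤ n → u ∉ C → (∀ y ∈ C, ∀ z, z ∉ C → G.Adj y z → z = u) →
    (∀ z₁ z₂, G.Adj u z₁ → G.Adj u z₂ → z₁ ∉ C → z₂ ∉ C → ¬ Light G w u z₁ → ¬ Light G w u z₂ →
      z₁ = z₂) →
    (∀ z, G.Adj u z → z ∉ C → ¬ Light G w u z → ¬ Light G w z u ∨
      ∀ y z₁ z₂, G.Adj y z₁ → G.Adj y z₂ → ¬ Light G w y z₁ → ¬ Light G w y z₂ → z₁ = z₂) →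
    Sweep G Set.univ (w + 1) C Set.univ := by
  classical
  have := Fintype.ofFinite V
  have hA := hG.isAcyclic
  induction n with
  | zero =>
    intro C u hn hu
    rw [Nat.le_zero, Set.ncard_eq_zero (Set.toFinite _)] at hn
    exact absurd (show u ∈ Cᶜ from hu) (hn ▸ Set.notMem_empty u)
  | succ n ih =>
    intro C u hn hu hC h1 h2
    let X : Finset V := Finset.univ.filter fun x => G.Adj u x ∧ x ∉ C ∧ Light G w u x
    have hXmem : ∀ x, x ∈ X ↔ G.Adj u x ∧ x ∉ C ∧ Light G w u x := fun x => by simp [X]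
    have hs := sweep_branches hA Set.univ hC X fun x hx =>
      ⟨((hXmem x).1 hx).1, ((hXmem x).1 hx).2.2⟩
    set C₁ := C ∪ ⋃ x ∈ X, branch G u x with hC₁
    have hC1 : ∀ y ∈ C₁, ∀ z, z ∉ C₁ → G.Adj y z → z = u := by
      intro y hy z hz hyz
      rcases hy with hy | hy
      · exact hC y hy z (fun h => hz (Or.inl h)) hyz
      · simp only [Set.mem_iUnion] at hy
        obtain ⟨x, hx, hy⟩ := hy
        exact (branch_boundary hA ((hXmem x).1 hx).1 hy
          (fun h => hz (Or.inr (Set.mem_biUnion hx h))) hyz).2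
    have hC2 : ∀ y ∈ insert u C₁, ∀ z, z ∉ insert u C₁ → G.Adj y z →
        G.Adj u z ∧ z ∉ C ∧ ¬ Light G w u z := by
      intro y hy z hz hyz
      have hzC : z ∉ C := fun h => hz (Or.inr (Or.inl h))
      rcases hy with rfl | hy
      · refine ⟨hyz, hzC, fun hl => hz (Or.inr (Or.inr ?_))⟩
        exact Set.mem_biUnion ((hXmem z).2 ⟨hyz, hzC, hl⟩) (self_mem_branch y z)
      · exact absurd (Or.inl (hC1 y hy z (fun h => hz (Or.inr h)) hyz)) hz
    have hcard : (insert u (outerBoundary G Set.univ (insert u C₁))).ncard ≤ w + 1 + 1 := by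
      have h : (outerBoundary G Set.univ (insert u C₁)).ncard ≤ 1 := by
        rw [Set.ncard_le_one_iff (Set.toFinite _)]
        rintro a b ⟨-, ha, y, hy, hya⟩ ⟨-, hb, y', hy', hyb⟩
        obtain ⟨p1, p2, p3⟩ := hC2 y hy a ha hya
        obtain ⟨q1, q2, q3⟩ := hC2 y' hy' b hb hyb
        exact h1 a b p1 q1 p2 q2 p3 q3
      exact (Set.ncard_insert_le _ _).trans (by omega)
    have hs2 := hs.step u hcard
    by_cases hh : ∃ z, G.Adj u z ∧ z ∉ C ∧ ¬ Light G w u z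
    · obtain ⟨z, huz, hzC, hzl⟩ := hh
      refine hs2.trans (ih _ z ?_ ?_ ?_ ?_ ?_)
      · have : (insert u C₁)ᶜ ⊂ Cᶜ := by
          refine ⟨Set.compl_subset_compl.2 fun y hy => Or.inr (Or.inl hy), fun h => ?_⟩
          exact h hu (Set.mem_insert _ _)
        have := Set.ncard_lt_ncard this (Set.toFinite _)
        omega
      · rintro (rfl | h | h)
        · exact G.loopless.irrefl _ huz
        · exact hzC h
        · simp only [Set.mem_iUnion] at h
          obtain ⟨x, hx, h⟩ := h
          have hx' := (hXmem x).1 hx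
          obtain rfl := eq_of_mem_branch hA hx'.1 huz h
          exact hzl hx'.2.2
      · intro y hy a ha hya
        obtain ⟨p1, p2, p3⟩ := hC2 y hy a ha hya
        exact h1 a z p1 huz p2 hzC p3 hzl
      · intro a b hza hzb ha hb hal hbl
        rcases h2 z huz hzC hzl with h | h
        · by_contra hne
          rcases h3 z u a b huz.symm hza hzb (fun h => ha (h ▸ Set.mem_insert _ _))
            (fun h => hb (h ▸ Set.mem_insert _ _)) hne with h' | h' | h'
          exacts [h h', hal h', hbl h']
        · exact h z a b hza hzb hal hbl
      · intro a hza ha hal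
        refine (h2 z huz hzC hzl).imp_left fun h h' => h (h'.mono ?_)
        exact branch_subset_branch hA hza.symm huz.symm fun h => ha (h ▸ Set.mem_insert _ _)
    · have : insert u C₁ = Set.univ := by
        refine eq_univ_of_no_boundary hG.connected (Set.mem_insert u _) fun y hy z hyz => ?_
        by_contra hz
        exact hh ⟨z, hC2 y hy z hz hyz⟩
      rwa [this] at hs2

theorem exists_three_not_light (hG : G.IsTree) {w : ℕ}
    (hS : ¬ Sweep G Set.univ (w + 1) ∅ Set.univ) :
    ∃ y z₁ z₂ z₃, G.Adj y z₁ ∧ G.Adj y z₂ ∧ G.Adj y z₃ ∧ z₁ ≠ z₂ ∧ z₁ ≠ z₃ ∧ z₂ ≠ z₃ ∧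
      ¬ Light G w y z₁ ∧ ¬ Light G w y z₂ ∧ ¬ Light G w y z₃ := by
  by_contra hcon
  have h3 : ∀ y z₁ z₂ z₃, G.Adj y z₁ → G.Adj y z₂ → G.Adj y z₃ → z₁ ≠ z₂ → z₁ ≠ z₃ → z₂ ≠ z₃ →
      Light G w y z₁ ∨ Light G w y z₂ ∨ Light G w y z₃ := by
    intro y z₁ z₂ z₃ a b c d e f
    by_contra h
    push Not at h
    exact hcon ⟨y, z₁, z₂, z₃, a, b, c, d, e, f, h⟩
  have hA := hG.isAcyclic
  refine hS ?_
  -- The path must start at one of its ends. Among edges heavy on both sides, one with the smallest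
  -- far side ends at such a vertex `u`: another heavy branch at `u` would give a smaller such edge.
  -- Without such edges no vertex has two heavy branches, and any start works.
  by_cases hm : ∃ n, ∃ v u, (branch G v u).ncard = n ∧ G.Adj v u ∧
      ¬ Light G w v u ∧ ¬ Light G w u v
  · classical
    obtain ⟨v, u, hn, hvu, hl, hl'⟩ := Nat.find_spec hm
    have hmin : ∀ z, G.Adj u z → ¬ Light G w u z → z = v := by
      intro z huz hz
      by_contra hne
      have hlt : (branch G u z).ncard < (branch G v u).ncard := by
        refine Set.ncard_lt_ncard ⟨branch_subset_branch hA hvu huz hne, fun h => ?_⟩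
          (Set.toFinite _)
        exact notMem_branch hA huz (h (self_mem_branch v u))
      rw [hn] at hlt
      exact Nat.find_min hm hlt ⟨u, z, rfl, huz, hz, fun h =>
        hl' (h.mono (branch_subset_branch hA huz.symm hvu.symm (Ne.symm hne)))⟩
    refine sweep_univ_of_boundary hG h3 _ ∅ u le_rfl (Set.notMem_empty _) (by simp) ?_ ?_
    · intro a b ha hb _ _ hal hbl
      rw [hmin a ha hal, hmin b hb hbl]
    · intro z huz _ hz
      obtain rfl := hmin z huz hz
      exact Or.inl hl
  · have h2 : ∀ y z₁ z₂, G.Adj y z₁ → G.Adj y z₂ → ¬ Light G w y z₁ → ¬ Light G w y z₂ →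
        z₁ = z₂ := by
      intro y a b ha hb hal hbl
      by_contra hne
      exact hm ⟨_, y, a, rfl, ha, hal, fun h =>
        hbl (h.mono (branch_subset_branch hA ha.symm hb (Ne.symm hne)))⟩
    obtain ⟨u⟩ := hG.connected.nonempty
    exact sweep_univ_of_boundary hG h3 _ ∅ u le_rfl (Set.notMem_empty _) (by simp)
      (fun a b ha hb _ _ => h2 u a b ha hb) fun _ _ _ _ => Or.inr h2

/-- Data of a vertex with three branches each of which has, one step further, a branch that is not
light. -/
theorem exists_spider (hG : G.IsTree) {w : ℕ} (hS : ¬ Sweep G Set.univ (w + 2) ∅ Set.univ) :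
    ∃ (v : V) (u x : Fin 3 → V), (∀ i, G.Adj v (u i)) ∧ Function.Injective u ∧
      (∀ i, G.Adj (u i) (x i)) ∧ (∀ i, x i ≠ v) ∧ ∀ i, ¬ Light G w (u i) (x i) := by
  obtain ⟨v, a, b, c, ha, hb, hc, hab, hac, hbc, hla, hlb, hlc⟩ := exists_three_not_light hG hS
  have h : ∀ u, G.Adj v u → ¬ Light G (w + 1) v u →
      ∃ x, G.Adj u x ∧ x ≠ v ∧ ¬ Light G w u x := by
    intro u hu hl
    by_contra h
    push Not at h
    exact hl (light_succ hG.isAcyclic hu h)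
  have hadj : ∀ i, G.Adj v (![a, b, c] i) := by simp [Fin.forall_fin_succ, ha, hb, hc]
  have hl : ∀ i, ¬ Light G (w + 1) v (![a, b, c] i) := by
    simp [Fin.forall_fin_succ, hla, hlb, hlc]
  choose x hx using fun i => h _ (hadj i) (hl i)
  refine ⟨v, ![a, b, c], x, hadj, ?_, fun i => (hx i).1, fun i => (hx i).2.1, fun i => (hx i).2.2⟩
  intro i j
  fin_cases i <;> fin_cases j <;> simp [hab, hac, hbc, hab.symm, hac.symm, hbc.symm]

theorem Sweep.of_induce {B : Set V} {w : ℕ} {D E : Set B}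
    (h : Sweep (G.induce B) Set.univ w D E) :
    Sweep G B w (Subtype.val '' D) (Subtype.val '' E) := by
  induction h with
  | refl => exact .refl
  | @step E v _ hv ih =>
    rw [Set.image_insert_eq]
    refine ih.step _ ?_
    rw [← Set.image_insert_eq]
    refine le_trans ?_ hv
    rw [← Set.ncard_image_of_injective (insert v _) Subtype.val_injective,
      Set.image_insert_eq (s := outerBoundary _ _ _)]
    refine Set.ncard_le_ncard (Set.insert_subset_insert ?_) (Set.toFinite _)
    rintro z ⟨hzB, hzn, _, ⟨y, hy, rfl⟩, hyz⟩
    exact ⟨⟨z, hzB⟩, ⟨trivial, fun h => hzn ⟨_, h, rfl⟩, y, hy, hyz⟩, rfl⟩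

theorem light_of_induce {w : ℕ} {u x : V}
    (h : Sweep (G.induce (branch G u x)) Set.univ w ∅ Set.univ) : Light G w u x := by
  simpa [Light] using h.of_induce

end Sweep

/-! ### From sweeps to path decompositions. -/

section Pathwidth

variable {V : Type*} {G : SimpleGraph V}

/-- The last two conditions carry the induction: an unswept vertex that has entered a bag stays in
all later ones, because it keeps a swept neighbor and so remains on the boundary. -/
theorem Sweep.exists_bags [Fintype V] {w : ℕ} {E : Set V} (h : Sweep G Set.univ w ∅ E) :
    ∃ (n : ℕ) (bag : ℕ → Finset V), (∀ i, (bag i).card ≤ w + 1) ∧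
      (∀ v ∈ E, ∃ i < n, v ∈ bag i) ∧
      (∀ i m j, i ≤ m → m ≤ j → j < n → ∀ v, v ∈ bag i → v ∈ bag j → v ∈ bag m) ∧
      (∀ u ∈ E, ∀ v, G.Adj u v → ∃ i < n, u ∈ bag i ∧ v ∈ bag i) ∧
      (∀ i j v, i ≤ j → j < n → v ∉ E → v ∈ bag i → v ∈ bag j) ∧
      ∀ i < n, ∀ v ∈ bag i, v ∉ E → ∃ u ∈ E, G.Adj u v := by
  classical
  induction h with
  | refl => exact ⟨0, fun _ => ∅, by simp⟩
  | @step E v _ hv ih =>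
    obtain ⟨n, bag, h1, h2, h3, h4, h5, h6⟩ := ih
    by_cases hvE : v ∈ E
    · rw [Set.insert_eq_of_mem hvE]
      exact ⟨n, bag, h1, h2, h3, h4, h5, h6⟩
    set N := insert v (outerBoundary G Set.univ (insert v E)) with hN
    have hNE : ∀ z ∈ N, z ∉ E := by
      rintro z (rfl | hz)
      · exact hvE
      · exact fun h => hz.2.1 (Or.inr h)
    let bag' : ℕ → Finset V := fun i => if i < n then bag i else N.toFinset
    have hlt : ∀ i, i < n → bag' i = bag i := fun i hi => if_pos hi
    have hn : bag' n = N.toFinset := if_neg (lt_irrefl n)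
    refine ⟨n + 1, bag', ?_, ?_, ?_, ?_, ?_, ?_⟩
    · intro i
      by_cases hi : i < n
      · rw [hlt i hi]; exact h1 i
      · simp only [bag', if_neg hi]
        rwa [← Set.ncard_eq_toFinset_card']
    · rintro z (rfl | hz)
      · exact ⟨n, n.lt_succ_self, by rw [hn]; simp [hN]⟩
      · obtain ⟨i, hi, hzi⟩ := h2 z hz
        exact ⟨i, by omega, by rwa [hlt i hi]⟩
    · intro i m j him hmj hj z hzi hzj
      rcases (Nat.lt_succ_iff.1 hj).lt_or_eq with hj' | rfl
      · rw [hlt _ (hmj.trans_lt hj')]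
        rw [hlt _ hj'] at hzj
        rw [hlt _ ((him.trans hmj).trans_lt hj')] at hzi
        exact h3 i m j him hmj hj' z hzi hzj
      · rcases hmj.lt_or_eq with hm | rfl
        · rw [hlt _ hm]
          rw [hlt _ (by omega)] at hzi
          rw [hn, Set.mem_toFinset] at hzj
          exact h5 i m z him hm (hNE z hzj) hzi
        · exact hzj
    · have hnew : ∀ u ∈ insert v E, ∀ z, G.Adj u z → u ∉ E →
          ∃ i < n + 1, u ∈ bag' i ∧ z ∈ bag' i := by
        intro u hu z huz huE
        obtain rfl : u = v := hu.resolve_right huE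
        by_cases hz : z ∈ E
        · obtain ⟨i, hi, a, b⟩ := h4 z hz u huz.symm
          exact ⟨i, by omega, by rwa [hlt i hi], by rwa [hlt i hi]⟩
        · refine ⟨n, n.lt_succ_self, by rw [hn]; simp [hN], ?_⟩
          rw [hn, Set.mem_toFinset]
          refine Or.inr ⟨trivial, ?_, u, Set.mem_insert _ _, huz⟩
          rintro (rfl | h)
          · exact G.loopless.irrefl _ huz
          · exact hz h
      intro u hu z huz
      by_cases huE : u ∈ E
      · obtain ⟨i, hi, a, b⟩ := h4 u huE z huz
        exact ⟨i, by omega, by rwa [hlt i hi], by rwa [hlt i hi]⟩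
      · exact hnew u hu z huz huE
    · intro i j z hij hj hz hzi
      rcases (Nat.lt_succ_iff.1 hj).lt_or_eq with hj' | rfl
      · rw [hlt _ (by omega)] at hzi
        rw [hlt _ hj']
        exact h5 i j z hij hj' (fun h => hz (Or.inr h)) hzi
      · rcases hij.lt_or_eq with hi | rfl
        · rw [hlt _ hi] at hzi
          obtain ⟨u, hu, huz⟩ := h6 i hi z hzi fun h => hz (Or.inr h)
          rw [hn, Set.mem_toFinset]
          exact Or.inr ⟨trivial, hz, u, Or.inr hu, huz⟩
        · exact hzi
    · intro i hi z hzi hz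
      rcases (Nat.lt_succ_iff.1 hi).lt_or_eq with hi' | rfl
      · rw [hlt _ hi'] at hzi
        obtain ⟨u, hu, huz⟩ := h6 i hi' z hzi fun h => hz (Or.inr h)
        exact ⟨u, Or.inr hu, huz⟩
      · rw [hn, Set.mem_toFinset] at hzi
        rcases hzi with rfl | h
        · exact absurd (Set.mem_insert _ _) hz
        · exact h.2.2

theorem Sweep.pathwidth_le [Fintype V] {w : ℕ} (h : Sweep G Set.univ w ∅ Set.univ) :
    pathwidth G ≤ w := by
  obtain ⟨n, bag, h1, h2, h3, h4, -, -⟩ := h.exists_bags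
  let B : PathDecomposition G :=
    { numBags := n
      bag := fun i => bag i
      cover := fun v => by
        obtain ⟨i, hi, hv⟩ := h2 v trivial
        exact ⟨⟨i, hi⟩, hv⟩
      interval := fun i m j him hmj v => h3 i m j him hmj j.2 v
      edge := fun u v huv => by
        obtain ⟨i, hi, hv⟩ := h4 u trivial v huv
        exact ⟨⟨i, hi⟩, hv⟩ }
  refine le_trans (Nat.sInf_le ⟨B, rfl⟩) ?_
  rw [PathDecomposition.width, Nat.sub_le_iff_le_add]
  exact Finset.sup_le fun i _ => h1 i

end Pathwidth

/-! ### Evolution of the dirt and speed of the cops. -/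

namespace CopSchedule

variable {V : Type*} {G : SimpleGraph V} {k : ℕ}

theorem mem_dirtyAfter_zero (π : CopSchedule G k) {z : V} :
    z ∈ π.dirtyAfter 0 ↔ z ∉ π.occupied 0 := by
  simp [dirtyAfter, dirtyBefore]

theorem notMem_occupied (π : CopSchedule G k) {t : ℕ} {z : V} (h : z ∈ π.dirtyAfter t) :
    z ∉ π.occupied t := h.2

/-- Cops block dirt at their positions both before and after the move, so every claim that dirt
spreads needs two consecutive free turns. -/
theorem mem_dirtyAfter_succ (π : CopSchedule G k) {t : ℕ} {z : V} :
    z ∈ π.dirtyAfter (t + 1) ↔ z ∉ π.occupied t ∧ z ∉ π.occupied (t + 1) ∧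
      (z ∈ π.dirtyAfter t ∨ ∃ y ∈ π.dirtyAfter t, G.Adj z y) := by
  change z ∈ ((openNbhd G (π.dirtyAfter t) ∪ π.dirtyAfter t) \ π.occupied t) \
    π.occupied (t + 1) ↔ _
  simp only [openNbhd, Set.mem_sdiff, Set.mem_union, Set.mem_ofPred_eq]
  by_cases h : z ∈ π.dirtyAfter t
  · simp only [h, not_true_eq_false, false_and, or_true, true_and, true_or, and_true]
  · simp only [h, not_false_eq_true, true_and, or_false, false_or]
    tauto

/-- The schedule started at turn `t₀` and stopped `N` turns later. -/
def window (π : CopSchedule G k) (t₀ N : ℕ) : CopSchedule G k where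
  pos s := π.pos (t₀ + min s N)
  move s c := by
    rcases Nat.lt_or_ge s N with h | h
    · rw [Nat.min_eq_left h.le, Nat.min_eq_left (Nat.succ_le_of_lt h)]
      exact π.move (t₀ + s) c
    · rw [Nat.min_eq_right h, Nat.min_eq_right (h.trans s.le_succ)]
      exact Or.inl rfl

theorem window_occupied (π : CopSchedule G k) {t₀ N s : ℕ} (h : s ≤ N) :
    (π.window t₀ N).occupied s = π.occupied (t₀ + s) := by
  simp [occupied, window, Nat.min_eq_left h]

/-- A function that changes by at most one along edges, and vanishes at the cops in turn `t`, is at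
most `s` at the cops `s` turns later. -/
theorem potential_le_after (π : CopSchedule G k) {φ : V → ℕ}
    (hφ : ∀ y z, G.Adj y z → φ y ≤ φ z + 1) {t : ℕ} (h0 : ∀ c, φ (π.pos t c) = 0) (s : ℕ)
    (c : Fin k) : φ (π.pos (t + s) c) ≤ s := by
  induction s with
  | zero => exact (h0 c).le
  | succ s ih =>
    rcases π.move (t + s) c with h | h
    · rw [← Nat.add_assoc, h]; omega
    · have := hφ _ _ h.symm
      rw [← Nat.add_assoc]; omega

theorem potential_le_before (π : CopSchedule G k) {φ : V → ℕ}
    (hφ : ∀ y z, G.Adj y z → φ y ≤ φ z + 1) (s : ℕ) : ∀ {t : ℕ},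
    (∀ c, φ (π.pos (t + s) c) = 0) → ∀ c, φ (π.pos t c) ≤ s := by
  induction s with
  | zero => exact fun h0 c => (h0 c).le
  | succ s ih =>
    intro t h0 c
    have h1 := ih (t := t + 1) (fun c => by rw [Nat.add_assoc, Nat.add_comm 1 s]; exact h0 c) c
    rcases π.move t c with h | h
    · rw [← h]; omega
    · have := hφ _ _ h
      omega

end CopSchedule

/-! ### Dirt survives in a branch that is never full. -/

section Persistence

variable {V : Type*} {G : SimpleGraph V}

/-- If `m` cops cannot clear a branch, and at every turn one of `m + 1` cops is outside of it, then
dirt can survive inside the branch. -/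
theorem exists_persistent_dirt (hG : G.IsAcyclic) {u x : V} (hux : G.Adj u x) {m : ℕ}
    (hB : ∀ σ : CopSchedule (G.induce (branch G u x)) m, ¬ σ.Clears)
    (π : CopSchedule G (m + 1)) (hout : ∀ s, ∃ c, π.pos s c ∉ branch G u x) :
    ∃ S : ℕ → Set V, (∀ s, (S s).Nonempty) ∧ (∀ s, S s ⊆ branch G u x) ∧
      (∀ s, ∀ z ∈ S s, z ∉ π.occupied s) ∧
      ∀ s, ∀ z ∈ S (s + 1), z ∉ π.occupied s ∧ (z ∈ S s ∨ ∃ y ∈ S s, G.Adj z y) := by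
  classical
  choose e he using hout
  -- Cops outside the branch are projected to its root, the only vertex through which the branch can
  -- be entered or left.
  let ρ : V → branch G u x := fun y => if h : y ∈ branch G u x then ⟨y, h⟩
    else ⟨x, self_mem_branch u x⟩
  have ρin : ∀ y (h : y ∈ branch G u x), ρ y = ⟨y, h⟩ := fun y h => dif_pos h
  have ρout : ∀ y, y ∉ branch G u x → ρ y = ⟨x, self_mem_branch u x⟩ := fun y h => dif_neg h
  have ρmove : ∀ y z, z = y ∨ G.Adj y z → ρ z = ρ y ∨ (G.induce (branch G u x)).Adj (ρ y) (ρ z) := by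
    rintro y z (rfl | h)
    · exact Or.inl rfl
    · by_cases hy : y ∈ branch G u x <;> by_cases hz : z ∈ branch G u x
      · rw [ρin y hy, ρin z hz]; exact Or.inr h
      · rw [ρin y hy, ρout z hz]
        exact Or.inl (Subtype.ext (branch_boundary hG hux hy hz h).1.symm)
      · rw [ρout y hy, ρin z hz]
        exact Or.inl (Subtype.ext (branch_boundary hG hux hz hy h.symm).1)
      · rw [ρout y hy, ρout z hz]; exact Or.inl rfl
  have ρexit : ∀ y z, z = y ∨ G.Adj y z → (y ∉ branch G u x → ρ z = ⟨x, self_mem_branch u x⟩) ∧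
      (z ∉ branch G u x → ρ y = ⟨x, self_mem_branch u x⟩) := by
    intro y z h
    constructor
    · intro hy
      by_cases hz : z ∈ branch G u x
      · rcases h with rfl | h
        · exact absurd hz hy
        · rw [ρin z hz]
          exact Subtype.ext (branch_boundary hG hux hz hy h.symm).1
      · exact ρout z hz
    · intro hz
      by_cases hy : y ∈ branch G u x
      · rcases h with rfl | h
        · exact absurd hy hz
        · rw [ρin y hy]
          exact Subtype.ext (branch_boundary hG hux hy hz h).1
      · exact ρout y hy
  -- The `m` shadow cops follow all real cops except `e s`, which is outside; `τ s` records who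
  -- follows whom.
  let τ : ℕ → Equiv.Perm (Fin (m + 1)) := fun s => Nat.rec (Equiv.swap (Fin.last m) (e 0))
    (fun s τ => Equiv.swap (e s) (e (s + 1)) * τ) s
  have τsucc : ∀ s c, τ (s + 1) c = Equiv.swap (e s) (e (s + 1)) (τ s c) := fun s c => rfl
  have τlast : ∀ s, τ s (Fin.last m) = e s := by
    intro s
    induction s with
    | zero => exact Equiv.swap_apply_left _ _
    | succ s ih => rw [τsucc, ih, Equiv.swap_apply_left]
  have τne : ∀ s (c : Fin m), τ s c.castSucc ≠ e s := by
    intro s c h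
    rw [← τlast s] at h
    exact (Fin.castSucc_lt_last c).ne ((τ s).injective h)
  let σ : CopSchedule (G.induce (branch G u x)) m :=
    { pos := fun s c => ρ (π.pos s (τ s c.castSucc))
      move := fun s c => by
        -- When the omitted cop changes, one shadow switches from `e (s + 1)` to `e s`. The former
        -- is outside after the move and the latter before it, so both relevant projections are the
        -- root and the shadow stands still.
        by_cases h : τ s c.castSucc = e (s + 1)
        · left
          rw [τsucc, h, Equiv.swap_apply_right, (ρexit _ _ (π.move s (e s))).1 (he s),
            (ρexit _ _ (π.move s (e (s + 1)))).2 (he (s + 1))]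
        · rw [τsucc, Equiv.swap_apply_of_ne_of_ne (τne s c) h]
          exact ρmove _ _ (π.move s _) }
  have hocc : ∀ s (z : branch G u x), (z : V) ∈ π.occupied s → z ∈ σ.occupied s := by
    rintro s z ⟨c, hc⟩
    have hne : (τ s).symm c ≠ Fin.last m := by
      intro h
      rw [Equiv.symm_apply_eq, τlast] at h
      exact he s (h ▸ hc ▸ z.2)
    obtain ⟨c', hc'⟩ := Fin.exists_castSucc_eq.2 hne
    refine ⟨c', ?_⟩
    change ρ (π.pos s (τ s c'.castSucc)) = z
    rw [hc', Equiv.apply_symm_apply, hc, ρin _ z.2]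
  refine ⟨fun s => Subtype.val '' σ.dirtyAfter s, ?_, ?_, ?_, ?_⟩
  · intro s
    by_contra h
    rw [Set.not_nonempty_iff_eq_empty, Set.image_eq_empty] at h
    exact hB σ ⟨s, h⟩
  · rintro s _ ⟨z, -, rfl⟩
    exact z.2
  · rintro s _ ⟨z, hz, rfl⟩ h
    exact σ.notMem_occupied hz (hocc s z h)
  · rintro s _ ⟨z, hz, rfl⟩
    obtain ⟨h1, -, h2⟩ := σ.mem_dirtyAfter_succ.1 hz
    refine ⟨fun h => h1 (hocc s z h), ?_⟩
    rcases h2 with h2 | ⟨y, hy, hzy⟩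
    · exact Or.inl ⟨z, h2, rfl⟩
    · exact Or.inr ⟨y, ⟨y, hy, rfl⟩, hzy⟩

end Persistence

/-! ### Dirt spreading ahead of the cops, and dirt following them. -/

section Wave

variable {V : Type*} {G : SimpleGraph V}

theorem exists_parent (hG : G.IsTree) {v y : V} (hne : y ≠ v) :
    ∃ z, G.Adj y z ∧ G.dist v z + 1 = G.dist v y ∧
      ∀ u, G.Adj u v → y ∈ branch G u v → z ∈ branch G u v := by
  obtain ⟨p, hp⟩ := (hG.connected y v).exists_walk_length_eq_dist
  cases p with
  | nil => exact absurd rfl hne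
  | @cons _ z _ h p =>
    refine ⟨z, h, ?_, ?_⟩
    · have h1 := dist_le p
      have h2 : G.dist v y ≤ G.dist v z + 1 := by
        have := hG.connected.dist_triangle (u := v) (v := z) (w := y)
        rwa [dist_eq_one_iff_adj.2 h.symm] at this
      rw [Walk.length_cons] at hp
      rw [G.dist_comm (u := v) (v := z), G.dist_comm (u := v) (v := y)] at *
      omega
    · intro u hu hy
      by_contra hz
      exact hne (branch_boundary hG.isAcyclic hu hy hz h).1

theorem exists_ancestor (hG : G.IsTree) {v : V} {s n : ℕ} : ∀ {y : V}, G.dist v y = s + n →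
    ∃ z, G.dist v z = s ∧ ∀ u, G.Adj u v → y ∈ branch G u v → z ∈ branch G u v := by
  induction n with
  | zero => exact fun {y} h => ⟨y, h, fun _ _ => id⟩
  | succ n ih =>
    intro y h
    have hne : y ≠ v := by
      rintro rfl
      simp at h
    obtain ⟨z, -, hz, hzb⟩ := exists_parent hG hne
    obtain ⟨a, ha, hab⟩ := ih (y := z) (by omega)
    exact ⟨a, ha, fun u hu hy => hab u hu (hzb u hu hy)⟩

/-- The distance to the neighbors of `u` other than `v` on the side of `v` of the edge `uv`; one at `u`
and zero elsewhere. -/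
noncomputable def potential (G : SimpleGraph V) (u v : V) (y : V) : ℕ :=
  open Classical in if y ∈ branch G u v then G.dist v y + 2 else if y = u then 1 else 0

theorem potential_le (hG : G.IsTree) {u v : V} (huv : G.Adj u v) (y z : V) (h : G.Adj y z) :
    potential G u v y ≤ potential G u v z + 1 := by
  have hA := hG.isAcyclic
  unfold potential
  by_cases hy : y ∈ branch G u v <;> by_cases hz : z ∈ branch G u v
  · have := hG.connected.dist_triangle (u := v) (v := z) (w := y)
    rw [dist_eq_one_iff_adj.2 h.symm] at this
    simp only [hy, hz, if_true]
    omega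
  · obtain ⟨rfl, rfl⟩ := branch_boundary hA huv hy hz h
    simp [hy, hz]
  · obtain ⟨rfl, rfl⟩ := branch_boundary hA huv hz hy h.symm
    simp [hy, hz]
  · simp only [hy, hz, if_false]
    split_ifs <;> omega

section

variable {k : ℕ} (π : CopSchedule G k) {u v x : V} {t : ℕ}

theorem potential_eq_zero (hG : G.IsAcyclic) (hux : G.Adj u x) (huv : G.Adj u v) (hxv : x ≠ v)
    {y : V} (hy : y ∈ branch G u x) : potential G u v y = 0 := by
  rw [potential, if_neg (Set.disjoint_left.1 (branch_disjoint hG hux huv hxv) hy), if_neg]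
  rintro rfl
  exact notMem_branch hG hux hy

theorem notMem_occupied_after (hG : G.IsTree) (hux : G.Adj u x) (huv : G.Adj u v) (hxv : x ≠ v)
    (ht : ∀ c, π.pos t c ∈ branch G u x) {s : ℕ} {y : V} (hy : y ∈ branch G u v)
    (hs : s < G.dist v y + 2) : y ∉ π.occupied (t + s) := by
  rintro ⟨c, rfl⟩
  have := π.potential_le_after (potential_le hG huv)
    (fun c => potential_eq_zero hG.isAcyclic hux huv hxv (ht c)) s c
  rw [potential, if_pos hy] at this
  omega

theorem notMem_occupied_before (hG : G.IsTree) (hux : G.Adj u x) (huv : G.Adj u v) (hxv : x ≠ v)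
    {s : ℕ} (ht : ∀ c, π.pos (t + s) c ∈ branch G u x) {y : V} (hy : y ∈ branch G u v)
    (hs : s < G.dist v y + 2) : y ∉ π.occupied t := by
  rintro ⟨c, rfl⟩
  have := π.potential_le_before (potential_le hG huv) s
    (fun c => potential_eq_zero hG.isAcyclic hux huv hxv (ht c)) c
  rw [potential, if_pos hy] at this
  omega

/-- When all cops are in the branch at `x`, dirt beyond `v` has followed them up to `v`. -/
theorem dirty_of_dirty_beyond (hG : G.IsTree) (hux : G.Adj u x) (huv : G.Adj u v) (hxv : x ≠ v)
    (ht : ∀ c, π.pos t c ∈ branch G u x) {y : V} (hy : y ∈ branch G u v)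
    (hyt : y ∈ π.dirtyAfter t) : v ∈ π.dirtyAfter t := by
  have hA := hG.isAcyclic
  -- With `s` turns left before turn `t`, dirt at distance at least `s` from `v` yields dirt at
  -- distance exactly `s`: the cops are already too close to the branch at `x` to block that level.
  have key : ∀ r s, r + s = t → ∀ y ∈ branch G u v, y ∈ π.dirtyAfter r → s ≤ G.dist v y →
      ∃ z ∈ branch G u v, z ∈ π.dirtyAfter r ∧ G.dist v z = s := by
    intro r
    induction r with
    | zero =>
      intro s hs y hy _ hd
      obtain ⟨z, hz, hzb⟩ := exists_ancestor hG (v := v) (s := s) (n := G.dist v y - s) (y := y)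
        (by omega)
      refine ⟨z, hzb u huv hy, π.mem_dirtyAfter_zero.2 ?_, hz⟩
      exact notMem_occupied_before π (s := s) hG hux huv hxv (hs ▸ ht) (hzb u huv hy) (by omega)
    | succ r ih =>
      intro s hs y hy hyr hd
      rcases hd.eq_or_lt with hd | hd
      · exact ⟨y, hy, hyr, hd.symm⟩
      have free : ∀ z ∈ branch G u v, G.dist v z = s →
          z ∉ π.occupied r ∧ z ∉ π.occupied (r + 1) := fun z hz hd =>
        -- Here both edges between `x` and `v` are needed: `s + 1` turns remain and the distance to
        -- `x` is `s + 2`.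
        ⟨notMem_occupied_before π (s := s + 1) hG hux huv hxv
          (by rw [show r + (s + 1) = t by omega]; exact ht) hz (by omega),
         notMem_occupied_before π (s := s) hG hux huv hxv (hs ▸ ht) hz (by omega)⟩
      obtain ⟨-, -, h⟩ := π.mem_dirtyAfter_succ.1 hyr
      obtain ⟨z, hzb, hzr, hzd⟩ : ∃ z ∈ branch G u v, z ∈ π.dirtyAfter r ∧ s ≤ G.dist v z := by
        rcases h with h | ⟨z, hz, hyz⟩
        · exact ⟨y, hy, h, hd.le⟩
        · refine ⟨z, ?_, hz, ?_⟩
          · by_contra hzn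
            obtain ⟨rfl, -⟩ := branch_boundary hA huv hy hzn hyz
            simp at hd
          · have := hG.connected.dist_triangle (u := v) (v := z) (w := y)
            rw [dist_eq_one_iff_adj.2 hyz.symm] at this
            omega
      rcases hzd.eq_or_lt with hzd | hzd
      · exact ⟨z, hzb, π.mem_dirtyAfter_succ.2
          ⟨(free z hzb hzd.symm).1, (free z hzb hzd.symm).2, Or.inl hzr⟩, hzd.symm⟩
      · obtain ⟨a, hab, har, had⟩ := ih (s + 1) (by omega) z hzb hzr hzd
        obtain ⟨b, hadj, hbd, hbb⟩ := exists_parent hG (v := v) (y := a) (by rintro rfl; simp at had)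
        have hb := hbb u huv hab
        exact ⟨b, hb, π.mem_dirtyAfter_succ.2 ⟨(free b hb (by omega)).1, (free b hb (by omega)).2,
          Or.inr ⟨a, har, hadj.symm⟩⟩, by omega⟩
  obtain ⟨z, -, hz, hzd⟩ := key t 0 rfl y hy hyt (Nat.zero_le _)
  rwa [hG.connected.dist_eq_zero_iff.1 hzd]

/-- After all cops have been in the branch at `x`, dirt spreads from `v` ahead of them. -/
theorem dirty_wave (hG : G.IsTree) (hux : G.Adj u x) (huv : G.Adj u v) (hxv : x ≠ v)
    (ht : ∀ c, π.pos t c ∈ branch G u x) (hv : v ∈ π.dirtyAfter t) (s : ℕ) :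
    ∀ y ∈ branch G u v, G.dist v y = s → y ∈ π.dirtyAfter (t + s) := by
  induction s with
  | zero =>
    intro y _ h
    rwa [← hG.connected.dist_eq_zero_iff.1 h]
  | succ s ih =>
    intro y hy hd
    obtain ⟨z, hadj, hzd, hzb⟩ := exists_parent hG (v := v) (y := y) (by rintro rfl; simp at hd)
    exact π.mem_dirtyAfter_succ.2 ⟨notMem_occupied_after π hG hux huv hxv ht hy (by omega),
      notMem_occupied_after π (s := s + 1) hG hux huv hxv ht hy (by omega),
      Or.inr ⟨z, ih z (hzb u huv hy) (by omega), hadj⟩⟩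

/-- After all cops have been in the branch at `x` while `v` was dirty, the region beyond `v` behaves
as if it had been completely dirty. -/
theorem dirty_of_virtual (hG : G.IsTree) (hux : G.Adj u x) (huv : G.Adj u v) (hxv : x ≠ v)
    (ht : ∀ c, π.pos t c ∈ branch G u x) (hv : v ∈ π.dirtyAfter t) {S : ℕ → Set V} {N : ℕ}
    (hS : ∀ s, S s ⊆ branch G u v) (hS0 : ∀ s ≤ N, ∀ z ∈ S s, z ∉ π.occupied (t + s))
    (hS1 : ∀ s < N, ∀ z ∈ S (s + 1), z ∉ π.occupied (t + s) ∧
      (z ∈ S s ∨ ∃ y ∈ S s, G.Adj z y)) (s : ℕ) : s ≤ N →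
    ∀ y ∈ S s, G.dist v y ≤ s → y ∈ π.dirtyAfter (t + s) := by
  have wave := dirty_wave π hG hux huv hxv ht hv
  induction s with
  | zero => exact fun _ y hy hd => wave 0 y (hS 0 hy) (by omega)
  | succ s ih =>
    intro hs y hy hd
    rcases hd.eq_or_lt with hd | hd
    · exact wave _ y (hS _ hy) hd
    obtain ⟨h1, h2⟩ := hS1 s (by omega) y hy
    refine π.mem_dirtyAfter_succ.2 ⟨h1, hS0 (s + 1) hs y hy, ?_⟩
    rcases h2 with h2 | ⟨z, hz, hyz⟩
    · exact Or.inl (ih (by omega) y h2 (by omega))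
    · by_cases hzd : G.dist v z ≤ s
      · exact Or.inr ⟨z, ih (by omega) z hz hzd, hyz⟩
      -- The virtual dirt comes from beyond the wave front, so `y` lies on the front and is really
      -- dirty already.
      · refine Or.inl (wave s y (hS _ hy) ?_)
        have := hG.connected.dist_triangle (u := v) (v := y) (w := z)
        rw [dist_eq_one_iff_adj.2 hyz] at this
        omega

end

end Wave

theorem exists_last_lt (P : ℕ → Prop) (n : ℕ) :
    (∃ m < n, P m ∧ ∀ k, m < k → k < n → ¬ P k) ∨ ∀ k < n, ¬ P k := by
  induction n with
  | zero => exact Or.inr fun k hk => absurd hk (Nat.not_lt_zero k)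
  | succ n ih =>
    by_cases h : P n
    · exact Or.inl ⟨n, n.lt_succ_self, h, fun k h1 h2 => by omega⟩
    · have hk : ∀ k, k < n + 1 → k < n ∨ k = n := fun k => Nat.lt_succ_iff_lt_or_eq.1
      rcases ih with ⟨m, hm, hP, hl⟩ | ih
      · refine Or.inl ⟨m, by omega, hP, fun k h1 h2 => ?_⟩
        rcases hk k h2 with h3 | rfl
        exacts [hl k h1 h3, h]
      · refine Or.inr fun k h2 => ?_
        rcases hk k h2 with h3 | rfl
        exacts [ih k h3, h]

/-! ### Three heavy inner branches defeat `m + 1` cops. -/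

section Spider

variable {V : Type*} {G : SimpleGraph V}

theorem not_clears_of_spider (hG : G.IsTree) {m : ℕ} {v : V} {u x : Fin 3 → V}
    (hvu : ∀ i, G.Adj v (u i)) (hu : Function.Injective u) (hux : ∀ i, G.Adj (u i) (x i))
    (hxv : ∀ i, x i ≠ v)
    (hB : ∀ i, ∀ σ : CopSchedule (G.induce (branch G (u i) (x i))) m, ¬ σ.Clears)
    (π : CopSchedule G (m + 1)) : ¬ π.Clears := by
  have hA := hG.isAcyclic
  let Ev : Fin 3 → ℕ → Prop := fun i t => ∀ c, π.pos t c ∈ branch G (u i) (x i)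
  have hsub : ∀ i j, i ≠ j → branch G (u i) (x i) ⊆ branch G (u j) v := fun i j hij =>
    (branch_subset_branch hA (hvu i) (hux i) (hxv i)).trans
      (branch_subset_branch hA (hvu j).symm (hvu i) fun h => hij (hu h))
  have hdisj : ∀ i j t, Ev i t → Ev j t → i = j := by
    intro i j t hi hj
    by_contra hij
    exact Set.disjoint_left.1 (branch_disjoint hA (hux j) (hvu j).symm (hxv j)) (hj 0)
      (hsub i j hij (hi 0))
  -- If the inner branch `l` is never full during the window, some dirt that every other leg sees
  -- beyond `v` exists at its end. The start is either the fully dirty graph or an event with `v`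
  -- dirty, which is as good.
  have key : ∀ l t₀ N, (t₀ = 0 ∨ ∃ j, j ≠ l ∧ Ev j t₀ ∧ v ∈ π.dirtyAfter t₀) →
      (∀ s ≤ N, ¬ Ev l (t₀ + s)) →
      ∃ y ∈ π.dirtyAfter (t₀ + N), ∀ j, j ≠ l → y ∈ branch G (u j) v := by
    intro l t₀ N hstart hno
    obtain ⟨S, hne, hSB, hS0, hS1⟩ := exists_persistent_dirt hA (hux l) (hB l) (π.window t₀ N)
      fun s => by
        have := hno (min s N) (min_le_right _ _)
        simp only [Ev, not_forall] at this
        exact this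
    have hS0' : ∀ s ≤ N, ∀ z ∈ S s, z ∉ π.occupied (t₀ + s) := fun s hs z hz => by
      rw [← π.window_occupied hs]; exact hS0 s z hz
    have hS1' : ∀ s < N, ∀ z ∈ S (s + 1), z ∉ π.occupied (t₀ + s) ∧
        (z ∈ S s ∨ ∃ y ∈ S s, G.Adj z y) := fun s hs z hz => by
      rw [← π.window_occupied hs.le]; exact hS1 s z hz
    obtain ⟨y, hy⟩ := hne N
    rcases hstart with rfl | ⟨j, hjl, hj, hv⟩
    · have : ∀ s ≤ N, S s ⊆ π.dirtyAfter (0 + s) := by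
        intro s
        induction s with
        | zero => exact fun hs z hz => π.mem_dirtyAfter_zero.2 (hS0' 0 hs z hz)
        | succ s ih =>
          intro hs z hz
          obtain ⟨h1, h2⟩ := hS1' s hs z hz
          refine π.mem_dirtyAfter_succ.2 ⟨h1, hS0' _ hs z hz, ?_⟩
          rcases h2 with h2 | ⟨y, hy, hzy⟩
          · exact Or.inl (ih (by omega) h2)
          · exact Or.inr ⟨y, ih (by omega) hy, hzy⟩
      exact ⟨y, this N le_rfl hy, fun j hj => hsub l j hj.symm (hSB N hy)⟩
    · have hyb : ∀ j, j ≠ l → y ∈ branch G (u j) v := fun j hj => hsub l j hj.symm (hSB N hy)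
      by_cases hd : G.dist v y ≤ N
      · refine ⟨y, ?_, hyb⟩
        exact dirty_of_virtual π hG (hux j) (hvu j).symm (hxv j) hj hv
          (fun s => (hSB s).trans (hsub l j hjl.symm)) hS0' hS1' N le_rfl y hy hd
      -- The wave has not yet reached `y`, but its front on the path from `v` to `y` is dirty.
      · obtain ⟨z, hz, hzb⟩ := exists_ancestor hG (v := v) (s := N) (n := G.dist v y - N) (y := y)
          (by omega)
        refine ⟨z, ?_, fun i hi => hzb _ (hvu i).symm (hyb i hi)⟩
        exact dirty_wave π hG (hux j) (hvu j).symm (hxv j) hj hv N z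
          (hzb _ (hvu j).symm (hyb j hjl)) hz
  have other : ∀ i j : Fin 3, ∃ l, l ≠ i ∧ l ≠ j := by decide
  have event : ∀ t i, Ev i t → v ∈ π.dirtyAfter t := by
    intro t
    induction t using Nat.strong_induction_on with
    | _ t ih =>
      intro i hi
      have finish : ∀ l, l ≠ i → (∃ y ∈ π.dirtyAfter t, ∀ j, j ≠ l → y ∈ branch G (u j) v) →
          v ∈ π.dirtyAfter t := by
        rintro l hl ⟨y, hy, hyb⟩
        exact dirty_of_dirty_beyond π hG (hux i) (hvu i).symm (hxv i) hi (hyb i hl.symm) hy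
      rcases exists_last_lt (fun t => ∃ j, Ev j t) t with ⟨τ, hτ, ⟨j, hj⟩, hlast⟩ | hno
      -- Three legs are needed here: `l` avoids both the current event and the previous one, so it
      -- is not full at any turn between them.
      · obtain ⟨l, hli, hlj⟩ := other i j
        refine finish l hli ?_
        have := key l τ (t - τ) (Or.inr ⟨j, hlj.symm, hj, ih τ hτ j hj⟩) ?_
        · rwa [show τ + (t - τ) = t by omega] at this
        · intro s hs hl
          rcases Nat.eq_zero_or_pos s with rfl | hs0
          · exact hlj (hdisj l j _ hl hj)
          · rcases (show τ + s < t ∨ τ + s = t by omega) with h | h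
            · exact hlast _ (by omega) h ⟨l, hl⟩
            · exact hli (hdisj l i t (h ▸ hl) hi)
      · obtain ⟨l, hli, -⟩ := other i i
        refine finish l hli ?_
        have := key l 0 t (Or.inl rfl) ?_
        · rwa [Nat.zero_add] at this
        · intro s hs hl
          rw [Nat.zero_add] at hl
          rcases hs.lt_or_eq with h | rfl
          · exact hno s h ⟨l, hl⟩
          · exact hli (hdisj l i s hl hi)
  rintro ⟨t, ht⟩
  rcases exists_last_lt (fun t => ∃ j, Ev j t) (t + 1) with ⟨τ, hτ, ⟨j, hj⟩, hlast⟩ | hno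
  · obtain ⟨l, hlj, -⟩ := other j j
    obtain ⟨y, hy, -⟩ := key l τ (t - τ) (Or.inr ⟨j, hlj.symm, hj, event τ j hj⟩) fun s hs hl => by
      rcases Nat.eq_zero_or_pos s with rfl | hs0
      · exact hlj (hdisj l j _ hl hj)
      · exact hlast _ (by omega) (by omega) ⟨l, hl⟩
    rw [show τ + (t - τ) = t by omega, ht] at hy
    exact hy
  · obtain ⟨y, hy, -⟩ := key 0 0 t (Or.inl rfl) fun s hs hl => by
      rw [Nat.zero_add] at hl
      exact hno s (by omega) ⟨0, hl⟩
    rw [Nat.zero_add, ht] at hy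
    exact hy

end Spider

theorem not_clears_zero {V : Type*} [Nonempty V] {G : SimpleGraph V} (π : CopSchedule G 0) :
    ¬ π.Clears := by
  have h : ∀ t, π.dirtyAfter t = Set.univ := by
    have hocc : ∀ t, π.occupied t = ∅ := fun t => Set.range_eq_empty _
    intro t
    refine Set.eq_univ_of_forall fun z => ?_
    induction t with
    | zero => simp [π.mem_dirtyAfter_zero, hocc]
    | succ t ih => simp [π.mem_dirtyAfter_succ, hocc, ih]
  rintro ⟨t, ht⟩
  exact Set.empty_ne_univ (ht.symm.trans (h t))

-- Each cop is worth two units of width: one for passing from the tree to the branches at `v`, one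
-- for passing to the inner branches.
universe u in
theorem sweep_of_clears (k : ℕ) : ∀ {V : Type u} [Finite V] {G : SimpleGraph V}, G.IsTree →
    ∀ π : CopSchedule G k, π.Clears → Sweep G Set.univ (2 * k) ∅ Set.univ := by
  induction k with
  | zero =>
    intro V _ G hG π hπ
    have := hG.connected.nonempty
    exact absurd hπ (not_clears_zero π)
  | succ m ih =>
    intro V _ G hG π hπ
    by_contra hS
    obtain ⟨v, u, x, h1, h2, h3, h4, h5⟩ := exists_spider hG hS
    refine not_clears_of_spider hG h1 h2 h3 h4 (fun i σ hσ => h5 i ?_) π hπ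
    exact light_of_induce (ih (isTree_induce_branch hG.isAcyclic _ _) σ hσ)

theorem pathwidth_le_two_mul_copNumber {V : Type*} [Fintype V] {T : SimpleGraph V}
    (hT : T.IsTree) : pathwidth T ≤ 2 * copNumber T := by
  obtain ⟨π, hπ⟩ := Nat.sInf_mem (copNumber_set_nonempty T)
  exact (sweep_of_clears _ hT π hπ).pathwidth_le

/-! ### From path decompositions to sweeps. -/

section Layout

variable {V : Type*} {G : SimpleGraph V}

/-- Vertices are added in the order of their last bags. A boundary vertex meets a swept vertex no
later than the last bag of `v` and lasts at least as long as `v`, so it lies in that bag. -/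
theorem PathDecomposition.sweep [Finite V] (B : PathDecomposition G) :
    Sweep G Set.univ B.width ∅ Set.univ := by
  classical
  have hlast : ∀ v, ∃ i, v ∈ B.bag i ∧ ∀ j, v ∈ B.bag j → j ≤ i := by
    intro v
    obtain ⟨i₀, hi₀⟩ := B.cover v
    obtain ⟨i, hi, hmax⟩ := Finset.exists_max_image (Finset.univ.filter fun i => v ∈ B.bag i) id
      ⟨i₀, by simpa using hi₀⟩
    exact ⟨i, by simpa using hi, fun j hj => hmax j (by simpa using hj)⟩
  choose last hmem hle using hlast
  have key : ∀ n, ∀ D : Set V, Dᶜ.ncard = n → (∀ y ∈ D, ∀ z, z ∉ D → last y ≤ last z) →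
      Sweep G Set.univ B.width D Set.univ := by
    intro n
    induction n with
    | zero =>
      intro D hD _
      rw [Set.ncard_eq_zero (Set.toFinite _), Set.compl_empty_iff] at hD
      rw [hD]
      exact .refl
    | succ n ih =>
      intro D hD hlow
      have hne : Dᶜ.Nonempty := by
        rw [← Set.ncard_pos (Set.toFinite _)]; omega
      obtain ⟨v, hv, hmin⟩ := Set.exists_min_image Dᶜ last (Set.toFinite _) hne
      have hlv : ∀ y ∈ insert v D, last y ≤ last v := by
        rintro y (rfl | hy)
        exacts [le_rfl, hlow y hy v hv]
      have hstep : Sweep G Set.univ B.width D (insert v D) := by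
        refine Sweep.refl.step v ?_
        have hsub : insert v (outerBoundary G Set.univ (insert v D)) ⊆ ↑(B.bag (last v)) := by
          rintro z (rfl | ⟨-, hz, y, hy, hyz⟩)
          · exact hmem z
          · obtain ⟨i, hyi, hzi⟩ := B.edge y z hyz
            exact B.interval i (last v) (last z) ((hle y i hyi).trans (hlv y hy))
              (hmin z fun h => hz (Or.inr h)) z hzi (hmem z)
        refine (Set.ncard_le_ncard hsub (Set.toFinite _)).trans ?_
        rw [Set.ncard_coe_finset]
        have := Finset.le_sup (f := fun i => (B.bag i).card) (Finset.mem_univ (last v))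
        exact this.trans (Nat.sub_le_iff_le_add.1 le_rfl)
      refine hstep.trans (ih _ ?_ ?_)
      · have : (insert v D)ᶜ = Dᶜ \ {v} := by
          ext z; simp [and_comm]
        rw [this, Set.ncard_sdiff_singleton_of_mem hv, hD]
        rfl
      · intro y hy z hz
        exact (hlv y hy).trans (hmin z fun h => hz (Or.inr h))
  exact key _ ∅ rfl (by simp)

end Layout

/-! ### From sweeps to cop strategies. -/

section Strategy

variable {V : Type*} {G : SimpleGraph V} {k : ℕ}

/-- Some schedule of `k` cops reaches positions `f` with the set `S` dirty. -/
def Reaches (G : SimpleGraph V) (f : Fin k → V) (S : Set V) : Prop :=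
  ∃ (π : CopSchedule G k) (t : ℕ), π.pos t = f ∧ π.dirtyAfter t = S

/-- The vertices that are dirty after the cops have moved from `f` to `g` when `S` was dirty. -/
def spread (G : SimpleGraph V) (f g : Fin k → V) (S : Set V) : Set V :=
  {z | z ∉ Set.range f ∧ z ∉ Set.range g ∧ (z ∈ S ∨ ∃ y ∈ S, G.Adj z y)}

theorem Reaches.step {f g : Fin k → V} {S : Set V} (h : Reaches G f S)
    (hg : ∀ c, g c = f c ∨ G.Adj (f c) (g c)) : Reaches G g (spread G f g S) := by
  obtain ⟨π, t, rfl, rfl⟩ := h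
  let π' : CopSchedule G k :=
    { pos := fun s => if s ≤ t then π.pos s else g
      move := fun s c => by
        rcases lt_trichotomy s t with h | rfl | h
        · rw [if_pos (Nat.succ_le_of_lt h), if_pos h.le]
          exact π.move s c
        · rw [if_pos le_rfl, if_neg (Nat.not_succ_le_self _)]
          exact hg c
        · rw [if_neg (by omega), if_neg (by omega)]
          exact Or.inl rfl }
  have hpos : ∀ s ≤ t, π'.pos s = π.pos s := fun s hs => if_pos hs
  have hpos' : π'.pos (t + 1) = g := if_neg (Nat.not_succ_le_self _)
  have hd : ∀ s ≤ t, π'.dirtyAfter s = π.dirtyAfter s := by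
    intro s
    induction s with
    | zero =>
      intro hs
      ext z
      rw [π.mem_dirtyAfter_zero, π'.mem_dirtyAfter_zero, CopSchedule.occupied,
        CopSchedule.occupied, hpos 0 hs]
    | succ s ih =>
      intro hs
      ext z
      rw [π.mem_dirtyAfter_succ, π'.mem_dirtyAfter_succ, ih (by omega)]
      simp only [CopSchedule.occupied]
      rw [hpos _ hs, hpos s (by omega)]
  refine ⟨π', t + 1, hpos', ?_⟩
  ext z
  rw [π'.mem_dirtyAfter_succ, hd t le_rfl]
  simp only [CopSchedule.occupied]
  rw [hpos t le_rfl, hpos']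
  rfl

theorem Reaches.disjoint_range {f : Fin k → V} {S : Set V} (h : Reaches G f S) :
    Disjoint S (Set.range f) := by
  obtain ⟨π, t, rfl, rfl⟩ := h
  exact Set.disjoint_left.2 fun z hz => π.notMem_occupied hz

/-- Dirt can enter `D` only through its outer boundary, which lies in `Y` and is free of dirt before
the move. -/
theorem spread_disjoint {f g : Fin k → V} {S D Y : Set V} (hD : Disjoint S D) (hY : Disjoint S Y)
    (hb : outerBoundary G Set.univ D ⊆ Y) : Disjoint (spread G f g S) D := by
  rw [Set.disjoint_left] at *
  rintro z ⟨-, -, hz | ⟨y, hy, hzy⟩⟩ hzD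
  · exact hD hz hzD
  · exact hY hy (hb ⟨trivial, hD hy, z, hzD, hzy⟩)

/-- The cops can bring about that `D` is clean and every vertex of `Y` is occupied. -/
def Guards (G : SimpleGraph V) (k : ℕ) (D Y : Set V) : Prop :=
  ∃ (f : Fin k → V) (S : Set V), Reaches G f S ∧ Y ⊆ Set.range f ∧ Disjoint S D

theorem Guards.mono {D Y Z : Set V} (h : Guards G k D Y) (hZ : Z ⊆ Y) : Guards G k D Z := by
  obtain ⟨f, S, h1, h2, h3⟩ := h
  exact ⟨f, S, h1, hZ.trans h2, h3⟩

theorem exists_spare {f : Fin k → V} {Y : Set V} (hY : Y ⊆ Set.range f) (hcard : Y.ncard < k) :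
    ∃ c, Y ⊆ f '' {c}ᶜ := by
  have : Nonempty (Fin k) := ⟨⟨0, by omega⟩⟩
  have hY' : ∀ y ∈ Y, ∃ c, f c = y := fun y hy => hY hy
  choose! a ha using hY'
  have hfin : Y.Finite := (Set.finite_range f).subset fun y hy => ⟨_, ha y hy⟩
  by_contra! hcon
  have huniv : a '' Y = Set.univ := by
    refine Set.eq_univ_of_forall fun c => ?_
    obtain ⟨y, hy, hn⟩ := Set.not_subset.1 (hcon c)
    refine ⟨y, hy, ?_⟩
    by_contra hne
    exact hn ⟨a y, hne, ha y hy⟩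
  have := Set.ncard_image_le (f := a) hfin
  rw [huniv, Set.ncard_univ, Nat.card_eq_fintype_card, Fintype.card_fin] at this
  omega

/-- A cop not needed on `Y` walks to `y` while the others stand still. -/
theorem Guards.fetch (hG : G.Connected) {D Y : Set V} (h : Guards G k D Y)
    (hb : outerBoundary G Set.univ D ⊆ Y) (hcard : Y.ncard < k) (y : V) :
    Guards G k D (insert y Y) := by
  classical
  obtain ⟨f, S, h1, h2, h3⟩ := h
  obtain ⟨c, hc⟩ := exists_spare h2 hcard
  have key : ∀ a b, G.Walk a b → ∀ (f : Fin k → V) S, Reaches G f S → f c = a → Y ⊆ f '' {c}ᶜ →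
      Disjoint S D → Guards G k D (insert b Y) := by
    intro a b p
    induction p with
    | nil =>
      intro f S h1 hfc hY hS
      refine ⟨f, S, h1, Set.insert_subset ⟨c, hfc⟩ (hY.trans (Set.image_subset_range _ _)), hS⟩
    | @cons a a' b hadj p ih =>
      intro f S h1 hfc hY hS
      refine ih (Function.update f c a') _ (h1.step (g := Function.update f c a') fun i => ?_)
        (Function.update_self _ _ _) ?_ (spread_disjoint hS
          (h1.disjoint_range.mono_right (hY.trans (Set.image_subset_range _ _))) hb)
      · by_cases hi : i = c
        · subst hi
          rw [Function.update_self, hfc]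
          exact Or.inr hadj
        · exact Or.inl (Function.update_of_ne hi _ _)
      · intro z hz
        obtain ⟨i, hi, rfl⟩ := hY hz
        exact ⟨i, hi, Function.update_of_ne hi _ _⟩
  obtain ⟨p⟩ := hG (f c) y
  exact key _ _ p f S h1 rfl hc h3

theorem Guards.fetch_all [Finite V] (hG : G.Connected) {D Y Z : Set V} (h : Guards G k D Y)
    (hb : outerBoundary G Set.univ D ⊆ Y) (hYZ : Y ⊆ Z) (hcard : Z.ncard ≤ k) :
    Guards G k D Z := by
  have key : ∀ n, ∀ Y, Y ⊆ Z → (Z \ Y).ncard = n → outerBoundary G Set.univ D ⊆ Y →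
      Guards G k D Y → Guards G k D Z := by
    intro n
    induction n with
    | zero =>
      intro Y hYZ hn _ h
      rw [Set.ncard_eq_zero (Set.toFinite _), Set.sdiff_eq_empty] at hn
      exact h.mono hn
    | succ n ih =>
      intro Y hYZ hn hb h
      have hne : (Z \ Y).Nonempty := by
        rw [← Set.ncard_pos (Set.toFinite _)]; omega
      obtain ⟨y, hyZ, hyY⟩ := hne
      have hlt : Y.ncard < Z.ncard :=
        Set.ncard_lt_ncard ⟨hYZ, fun h => hyY (h hyZ)⟩ (Set.toFinite _)
      refine ih (insert y Y) (Set.insert_subset hyZ hYZ) ?_ (hb.trans (Set.subset_insert _ _))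
        (h.fetch hG hb (by omega) y)
      have : Z \ insert y Y = (Z \ Y) \ {y} := by
        ext z
        simp only [Set.mem_sdiff, Set.mem_insert_iff, Set.mem_singleton_iff]
        tauto
      have hy : y ∈ Z \ Y := ⟨hyZ, hyY⟩
      rw [this, Set.ncard_sdiff_singleton_of_mem hy, hn]
      rfl
  exact key _ Y hYZ rfl hb h

theorem Guards.insert_vertex [Finite V] [Nontrivial V] (hG : G.Connected) {E : Set V} {v : V}
    (h : Guards G k E (outerBoundary G Set.univ E))
    (hcard : (insert v (outerBoundary G Set.univ (insert v E))).ncard ≤ k + 1) :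
    Guards G k (insert v E) (outerBoundary G Set.univ (insert v E)) := by
  classical
  by_cases hvE : v ∈ E
  · rwa [Set.insert_eq_of_mem hvE]
  set M := outerBoundary G Set.univ (insert v E) with hM
  set Y := outerBoundary G Set.univ E with hY
  have hvM : v ∉ M := fun h => h.2.1 (Set.mem_insert _ _)
  rw [Set.ncard_insert_of_notMem hvM (Set.toFinite _)] at hcard
  have hYM : Y ⊆ insert v M := by
    rintro z ⟨-, hz, y, hy, hyz⟩
    by_cases hzv : z = v
    · exact Or.inl hzv
    · exact Or.inr ⟨trivial, fun h => h.elim hzv hz, y, Or.inr hy, hyz⟩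
  by_cases hvY : v ∈ Y
  · by_cases hMY : M ⊆ Y
    · obtain ⟨f, S, h1, h2, h3⟩ := h
      refine ⟨f, S, h1, hMY.trans h2, ?_⟩
      rw [Set.disjoint_insert_right]
      exact ⟨fun hv => Set.disjoint_left.1 h1.disjoint_range hv (h2 hvY), h3⟩
    -- The cop on `v` is reused for `y`: all of the new boundary except `y` is occupied first, then
    -- this cop slides from `v` to `y`.
    · obtain ⟨y, hyM, hyY⟩ := Set.not_subset.1 hMY
      have hadj : G.Adj v y := by
        obtain ⟨-, hyn, z, hz | hz, hzy⟩ := hyM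
        · rwa [← hz]
        · have hy' : y ∈ Y := ⟨trivial, fun h => hyn (Or.inr h), z, hz, hzy⟩
          exact absurd hy' hyY
      have hYsub : Y ⊆ insert v (M \ {y}) := by
        intro z hz
        rcases hYM hz with h | h
        · exact Or.inl h
        · exact Or.inr ⟨h, fun hzy => hyY (hzy ▸ hz)⟩
      obtain ⟨f, S, h1, h2, h3⟩ := h.fetch_all hG subset_rfl hYsub (by
        have := Set.ncard_insert_le v (M \ {y})
        rw [Set.ncard_sdiff_singleton_of_mem hyM] at this
        have : 0 < M.ncard := (Set.ncard_pos (Set.toFinite _)).2 ⟨y, hyM⟩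
        omega)
      obtain ⟨c, hc⟩ := h2 (Set.mem_insert v _)
      refine ⟨Function.update f c y, _, h1.step fun i => ?_, ?_, ?_⟩
      · by_cases hi : i = c
        · subst hi
          rw [Function.update_self, hc]
          exact Or.inr hadj
        · exact Or.inl (Function.update_of_ne hi _ _)
      · intro z hz
        by_cases hzy : z = y
        · exact ⟨c, by rw [hzy, Function.update_self]⟩
        · obtain ⟨i, rfl⟩ := h2 (Or.inr ⟨hz, hzy⟩)
          refine ⟨i, Function.update_of_ne ?_ _ _⟩
          rintro rfl
          exact hvM (hc ▸ hz)
      · rw [Set.disjoint_insert_right]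
        exact ⟨fun hv => hv.1 ⟨c, hc⟩, spread_disjoint h3
          (h1.disjoint_range.mono_right (hYsub.trans h2)) subset_rfl⟩
  · have hYM' : Y ⊆ M := fun z hz => (hYM hz).resolve_left fun h => hvY (h ▸ hz)
    -- No neighbor of `v` is swept, so a neighbor `w` lies on the new boundary. Its cop visits `v`
    -- and returns; the rest of the guard stays, and `w` is protected at both ends of each move.
    obtain ⟨w, hvw⟩ := hG.preconnected.exists_adj_of_nontrivial v
    have hwM : w ∈ M := by
      refine ⟨trivial, ?_, v, Set.mem_insert _ _, hvw⟩
      rintro (rfl | hw)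
      · exact G.loopless.irrefl _ hvw
      · exact hvY ⟨trivial, hvE, w, hw, hvw.symm⟩
    obtain ⟨f, S, h1, h2, h3⟩ := h.fetch_all hG subset_rfl hYM' (by omega)
    obtain ⟨c, hc⟩ := h2 hwM
    have hmove : ∀ i, Function.update f c v i = f i ∨ G.Adj (f i) (Function.update f c v i) := by
      intro i
      by_cases hi : i = c
      · subst hi
        rw [Function.update_self, hc]
        exact Or.inr hvw.symm
      · exact Or.inl (Function.update_of_ne hi _ _)
    have h4 := spread_disjoint (f := f) (g := Function.update f c v) h3
      (h1.disjoint_range.mono_right (hYM'.trans h2)) subset_rfl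
    refine ⟨f, _, (h1.step hmove).step fun i => (hmove i).imp Eq.symm fun h => h.symm, h2, ?_⟩
    rw [Set.disjoint_insert_right]
    refine ⟨fun hv => hv.1 ⟨c, Function.update_self _ _ _⟩, spread_disjoint (Y := M) h4 ?_ hYM'⟩
    exact Set.disjoint_left.2 fun z hz hzM => hz.1 (h2 hzM)

theorem Sweep.exists_clears [Finite V] [Nontrivial V] (hG : G.Connected)
    (h : Sweep G Set.univ k ∅ Set.univ) : ∃ π : CopSchedule G k, π.Clears := by
  have key : ∀ E, Sweep G Set.univ k ∅ E → Guards G k E (outerBoundary G Set.univ E) := by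
    intro E hE
    induction hE with
    | refl =>
      obtain ⟨v⟩ := hG.nonempty
      refine ⟨fun _ => v, _, ⟨⟨fun _ _ => v, fun _ _ => Or.inl rfl⟩, 0, rfl, rfl⟩, ?_, by simp⟩
      rintro z ⟨-, -, y, hy, -⟩
      exact absurd hy (Set.notMem_empty y)
    | step v _ hv ih => exact ih.insert_vertex hG hv
  obtain ⟨f, S, ⟨π, t, -, rfl⟩, -, hS⟩ := key _ h
  exact ⟨π, t, Set.disjoint_univ.1 hS⟩

theorem copNumber_le_pathwidth [Fintype V] [Nontrivial V] (hG : G.Connected) :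
    copNumber G ≤ pathwidth G := by
  obtain ⟨B, hB⟩ := Nat.sInf_mem (pathwidth_set_nonempty G)
  refine Nat.sInf_le (Sweep.exists_clears hG ?_)
  have h := B.sweep
  rwa [hB] at h

end Strategy

end ZeroVisibility

theorem mainTheorem9 {V : Type*} [Fintype V] (T : SimpleGraph V) (hT : T.IsTree)
    (hV : 2 ≤ Fintype.card V) :
    ⌈(ZeroVisibility.pathwidth T : ℚ) / 2⌉ ≤ (ZeroVisibility.copNumber T : ℤ) ∧
      ZeroVisibility.copNumber T ≤ ZeroVisibility.pathwidth T := by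
  have : Nontrivial V := Fintype.one_lt_card_iff_nontrivial.1 hV
  refine ⟨?_, ZeroVisibility.copNumber_le_pathwidth hT.connected⟩
  rw [Int.ceil_le, div_le_iff₀ two_pos, mul_comm]
  exact_mod_cast ZeroVisibility.pathwidth_le_two_mul_copNumber hT
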